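/- Let $K$ be a field, $n\ge 2$ and $t\ge 1$ integers, and $S=K[x_1,\ldots,x_n]$. For $1\le k\le n$ let $f_k=x_kx_{k+1}\cdots x_{k+n-3}$ be the product of the $n-2$ cyclically consecutive variables starting at $x_k$ (indices modulo $n$; $f_k=1$ if $n=2$), so that for $n\ge 3$ the ideal $(f_1,\ldots,f_n)$ is the $(n-2)$-path ideal of the $n$-cycle. Let $J_n=(f_1,f_3,f_4,\ldots,f_n)\subseteq S$ be the ideal generated by all $f_k$ with $k\ne 2$ (so $J_2=S$). For an $S$-module $M$ put $\beta_i(M)=\dim_K\operatorname{Tor}_i^S(K,M)$, where $K=S/(x_1,\ldots,x_n)$, and $\operatorname{pd}(M)=\sup\{i:\beta_i(M)\ne 0\}$. Then for all $i\ge 0$ $$\beta_i(J_n^t)=\binom{n-2}{i}\binom{n+t-i-2}{t-i},$$ where the right-hand side is read as $0$ if $i>t$ or $i>n-2$. In particular, $\operatorname{pd}(J_n^t)=\min(n-2,t)$. -/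

import Mathlib

/-! Write `I_q` for the ideal generated by the complements of the edges of the path on the vertices
`0, …, q + 1`. The omitted generator `f_2` is the complement of the edge `{x_n, x_1}` of the
`n`-cycle, and removing that edge leaves a path, so `J_n = I_{n-2}`. Lengthening the path by a
vertex `y = x_{q+2}` multiplies the old complements by `y` and adds one that avoids `y`, so
`I_{q+1} = y I_q + (p)` with `p = x_q g`, where `g = x_0 ⋯ x_{q-1}` lies in `I_q`. Hence, for
`L = I_{q+1}` and `I = I_q`,

  `L^{t+1} = (y I)^{t+1} + p L^t`  and  `(y I)^{t+1} ∩ p L^t = y^{t+1} p I^t`,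

the second because `y` does not occur in the monomial generators of `I^t` and does not divide `p`.
The intersection lies in `x_q (y I)^{t+1}` and in `y (p L^t)`, so both of its inclusions are
multiples of a variable and vanish on `Tor(K, -)`: the sum is a Betti splitting, and

  `β_i(L^{t+1}) = β_i(I^{t+1}) + β_i(L^t) + β_{i-1}(I^t)`.

The numbers `C(q, i) C(q + t - i, t - i)` satisfy the same recursion by Pascal's rule.
-/

open CategoryTheory

universe u

/-- The `S`-module `Tor_i^S(k, M)` for `S = K[x_1, …, x_n]`, where `k` is the field `K` viewed as
the `S`-module `S / (x_1, …, x_n)`. -/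
noncomputable def torResidueField (K : Type u) [Field K] (n : ℕ) (M : Type u) [AddCommGroup M]
    [Module (MvPolynomial (Fin n) K) M] (i : ℕ) : ModuleCat.{u} (MvPolynomial (Fin n) K) :=
  ((Tor (ModuleCat.{u} (MvPolynomial (Fin n) K)) i).obj
    (ModuleCat.of (MvPolynomial (Fin n) K)
      (MvPolynomial (Fin n) K ⧸
        Ideal.span (Set.range (MvPolynomial.X : Fin n → MvPolynomial (Fin n) K))))).obj
    (ModuleCat.of (MvPolynomial (Fin n) K) M)

/-- The `i`-th Betti number `β_i(M) = dim_K Tor_i^S(k, M)`, as a cardinal (so that it has no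
default value), for a module `M` over `S = K[x_1, …, x_n]`. -/
noncomputable def bettiNumber (K : Type u) [Field K] (n : ℕ) (M : Type u) [AddCommGroup M]
    [Module (MvPolynomial (Fin n) K) M] (i : ℕ) : Cardinal.{u} :=
  Module.rank K
    ((ModuleCat.restrictScalars (algebraMap K (MvPolynomial (Fin n) K))).obj
      (torResidueField K n M i))

/-- The projective dimension `pd_S(M) = sup {i | β_i(M) ≠ 0}`; the supremum is taken in
`ℕ ∪ {-∞, ∞}`, so it is `-∞` if all Betti numbers vanish. -/
noncomputable def bettiProjDim (K : Type u) [Field K] (n : ℕ) (M : Type u) [AddCommGroup M]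
    [Module (MvPolynomial (Fin n) K) M] : WithBot ℕ∞ :=
  sSup ((fun i : ℕ => (i : WithBot ℕ∞)) '' {i : ℕ | bettiNumber K n M i ≠ 0})

/-- The monomial `x_k x_{k+1} ⋯ x_{k+m-1}` of the `m` consecutive vertices of the `n`-cycle that
start at `k`, with indices modulo `n`. The variables `x_1, …, x_n` are indexed by
`0, …, n - 1`. -/
noncomputable def cyclePathMonomial (K : Type u) [Field K] (n m : ℕ) (k : Fin n) :
    MvPolynomial (Fin n) K :=
  ∏ j ∈ Finset.range m, MvPolynomial.X ⟨(k.val + j) % n, Nat.mod_lt _ k.pos⟩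

/-- The ideal `J_n = (f_1, f_3, …, f_n)` of `K[x_1, …, x_n]`, where
`f_1 = x_1 ⋯ x_{n-2}, …, f_n = x_n x_1 ⋯ x_{n-3}` are the generators of the `(n-2)`-path ideal
of the `n`-cycle. The omitted `f_2` has index `1` when counting from `0`. For `n = 2` it is the
unit ideal. -/
noncomputable def truncatedCyclePathIdeal (K : Type u) [Field K] (n : ℕ) :
    Ideal (MvPolynomial (Fin n) K) :=
  Ideal.span {f | ∃ k : Fin n, k.val ≠ 1 ∧ f = cyclePathMonomial K n (n - 2) k}

section Resolution

open Limits

variable {A : Type*} [Category* A] [Abelian A]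

lemma exact_comp_kernel_ι_comp_mono {X Y Z W : A} (f : Y ⟶ Z) (e : X ⟶ kernel f) [Epi e]
    (m : Z ⟶ W) [Mono m] :
    (ShortComplex.mk (e ≫ kernel.ι f) (f ≫ m) (by simp)).Exact := by
  let φ : ShortComplex.mk (e ≫ kernel.ι f) f (by simp) ⟶
      ShortComplex.mk (e ≫ kernel.ι f) (f ≫ m) (by simp) :=
    { τ₁ := 𝟙 _
      τ₂ := 𝟙 _
      τ₃ := m }
  have hlift : kernel.lift f (e ≫ kernel.ι f) (by simp) = e := by
    rw [← cancel_mono (kernel.ι f), kernel.lift_ι]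
  rw [← ShortComplex.exact_iff_of_epi_of_isIso_of_mono φ, ShortComplex.exact_iff_epi_kernel_lift]
  simpa only [hlift]

lemma quasiIso_toSingle₀Equiv_symm (K : ChainComplex A ℕ) {X : A} (ε : K.X 0 ⟶ X) [Epi ε]
    (w : K.d 1 0 ≫ ε = 0) (h₀ : (ShortComplex.mk _ _ w).Exact)
    (h : ∀ n, (ShortComplex.mk _ _ (K.d_comp_d (n + 2) (n + 1) n)).Exact) :
    QuasiIso ((ChainComplex.toSingle₀Equiv K X).symm ⟨ε, w⟩) where
  quasiIsoAt n := by
    cases n with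
    | zero =>
      rw [ChainComplex.quasiIsoAt₀_iff, ShortComplex.quasiIso_iff_of_zeros']
      · refine (ShortComplex.exact_and_epi_g_iff_of_iso ?_).2 ⟨h₀, inferInstance⟩
        have hε : ε = ((ChainComplex.toSingle₀Equiv K X).symm ⟨ε, w⟩).f 0 :=
          (ChainComplex.toSingle₀Equiv_symm_apply_f_zero _ _).symm
        exact ShortComplex.isoMk (Iso.refl _) (Iso.refl _) (Iso.refl _)
          ((Category.id_comp _).trans (Category.comp_id _).symm)
          ((Category.id_comp _).trans (hε.trans (Category.comp_id _).symm))
      all_goals first | rfl | exact K.shape _ _ (by simp)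
    | succ n =>
      rw [quasiIsoAt_iff_exactAt' _ _ (ChainComplex.exactAt_succ_single_obj _ _),
        HomologicalComplex.exactAt_iff' _ _ _ _ (ChainComplex.prev _ _)
          (ChainComplex.next_nat_succ _)]
      exact h n

theorem exists_quasiIso_single₀_of_exists_epi {P W : ObjectProperty A}
    (h : ∀ X, W X → ∃ (Y : A) (p : Y ⟶ X), P Y ∧ Epi p ∧ W (kernel p)) {X : A} (hX : W X) :
    ∃ (K : ChainComplex A ℕ) (π : K ⟶ (ChainComplex.single₀ A).obj X),
      (∀ n, P (K.X n)) ∧ QuasiIso π := by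
  choose Y p hP hp hW using fun X : {X // W X} => h X.1 X.2
  let Z (n : ℕ) : {X // W X} := n.rec ⟨X, hX⟩ fun _ Z => ⟨kernel (p Z), hW Z⟩
  let q (n : ℕ) : Y (Z (n + 1)) ⟶ kernel (p (Z n)) := p (Z (n + 1))
  have (n : ℕ) : Epi (q n) := hp _
  have w (n : ℕ) : (q (n + 1) ≫ kernel.ι (q n)) ≫ q n ≫ kernel.ι (p (Z n)) = 0 := by simp
  let K : ChainComplex A ℕ :=
    ChainComplex.of (fun n => Y (Z n)) (fun n => q n ≫ kernel.ι (p (Z n))) w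
  have hK (n : ℕ) : K.d (n + 1) n = q n ≫ kernel.ι (p (Z n)) :=
    ChainComplex.of_d (fun n => Y (Z n)) (fun n => q n ≫ kernel.ι (p (Z n))) n
  have : Epi (p (Z 0)) := hp _
  have w₀ : K.d 1 0 ≫ p (Z 0) = 0 := by simp [hK 0]
  refine ⟨K, _, fun n => hP (Z n), quasiIso_toSingle₀Equiv_symm K (p (Z 0)) w₀ ?_ fun n => ?_⟩
  · have := exact_comp_kernel_ι_comp_mono (p (Z 0)) (q 0) (𝟙 _)
    simpa only [hK, Category.comp_id] using this
  · simpa only [hK] using exact_comp_kernel_ι_comp_mono (q n) (q (n + 1)) (kernel.ι (p (Z n)))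

end Resolution

section Horseshoe

open Limits

variable {C : Type*} [Category* C] [Abelian C]

lemma shortExact_kernel {P S : ShortComplex C} (p : P ⟶ S) (hP : P.ShortExact)
    (hS : S.ShortExact) [Epi p.τ₁] : (kernel p).ShortExact := by
  let σ : ShortComplex.SnakeInput C :=
    { L₀ := kernel p
      L₁ := P
      L₂ := S
      L₃ := cokernel p
      v₀₁ := kernel.ι p
      v₁₂ := p
      v₂₃ := cokernel.π p
      w₀₂ := kernel.condition p
      w₁₃ := cokernel.condition p
      h₀ := kernelIsKernel p
      h₃ := cokernelIsCokernel p
      L₁_exact := hP.exact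
      epi_L₁_g := hP.epi_g
      L₂_exact := hS.exact
      mono_L₂_f := hS.mono_f }
  have : Mono σ.L₁.f := hP.mono_f
  have : Epi σ.v₁₂.τ₁ := ‹Epi p.τ₁›
  have : Epi σ.v₂₃.τ₁ := σ.epi_v₂₃_τ₁
  have hcokernel : IsZero σ.L₃.X₁ := by
    rw [IsZero.iff_id_eq_zero, ← cancel_epi σ.v₂₃.τ₁, zero_of_epi_comp _ σ.w₁₃_τ₁, zero_comp,
      zero_comp]
  exact
    { exact := σ.L₀_exact
      mono_f := σ.mono_L₀_f
      epi_g := (σ.L₁'.exact_iff_epi (hcokernel.eq_of_tgt _ _)).1 σ.L₁'_exact }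

lemma epi_of_epi_τ {P S : ShortComplex C} (p : P ⟶ S) [Epi p.τ₁] [Epi p.τ₂] [Epi p.τ₃] : Epi p where
  left_cancellation a b h := by
    ext
    · exact (cancel_epi p.τ₁).1 congr(($h).τ₁)
    · exact (cancel_epi p.τ₂).1 congr(($h).τ₂)
    · exact (cancel_epi p.τ₃).1 congr(($h).τ₃)

/-- The short exact sequences of projective objects. They are not the projective objects of the
category of short complexes, but they suffice to resolve short exact sequences. -/
def IsProjectiveShortExact : ObjectProperty (ShortComplex C) := fun P =>
  P.ShortExact ∧ Projective P.X₁ ∧ Projective P.X₂ ∧ Projective P.X₃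

variable [EnoughProjectives C]

lemma exists_epi_of_isProjectiveShortExact {S : ShortComplex C} (hS : S.ShortExact) :
    ∃ (P : ShortComplex C) (p : P ⟶ S),
      IsProjectiveShortExact P ∧ Epi p ∧ (kernel p).ShortExact := by
  have := hS.epi_g
  let P : ShortComplex C := ShortComplex.mk
    (biprod.inl : Projective.over S.X₁ ⟶ Projective.over S.X₁ ⊞ Projective.over S.X₂)
    biprod.snd (by simp)
  have hP : P.ShortExact := (ShortComplex.Splitting.ofHasBinaryBiproduct _ _).shortExact
  let p : P ⟶ S :=
    { τ₁ := Projective.π S.X₁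
      τ₂ := biprod.desc (Projective.π S.X₁ ≫ S.f) (Projective.π S.X₂)
      τ₃ := Projective.π S.X₂ ≫ S.g
      comm₁₂ := by simp [P]
      comm₂₃ := by
        dsimp only [P]
        ext <;> simp }
  have : Epi p.τ₁ := inferInstanceAs (Epi (Projective.π S.X₁))
  have : Epi (biprod.inr ≫ p.τ₂) := by simpa [p] using Projective.π_epi S.X₂
  have : Epi p.τ₂ := epi_of_epi biprod.inr p.τ₂
  have : Epi p.τ₃ := epi_comp _ _
  have hproj : Projective P.X₁ ∧ Projective P.X₂ ∧ Projective P.X₃ := by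
    refine ⟨?_, ?_, ?_⟩ <;> dsimp only [P] <;> infer_instance
  exact ⟨P, p, ⟨hP, hproj⟩, epi_of_epi_τ p, shortExact_kernel p hP hS⟩

end Horseshoe

section Map

variable {A C : Type*} [Category* A] [Abelian A] [Category* C] [Abelian C]

/-- The projective resolution of `G.obj X` obtained by applying an exact functor `G` to a
resolution of `X` whose terms `G` maps to projective objects. -/
noncomputable def mapResolution (G : A ⥤ C) [G.Additive]
    [G.PreservesHomology] {K : ChainComplex A ℕ} {X : A} (π : K ⟶ (ChainComplex.single₀ A).obj X)
    [QuasiIso π] (hK : ∀ n, Projective (G.obj (K.X n))) : ProjectiveResolution (G.obj X) where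
  complex := (G.mapHomologicalComplex _).obj K
  projective := hK
  π := (G.mapHomologicalComplex _).map π ≫
    (HomologicalComplex.singleMapHomologicalComplex _ _ _).hom.app _
  quasiIso := inferInstance

lemma mapResolution_π_f_zero (G : A ⥤ C) [G.Additive] [G.PreservesHomology]
    {K : ChainComplex A ℕ} {X : A} (π : K ⟶ (ChainComplex.single₀ A).obj X) [QuasiIso π]
    (hK : ∀ n, Projective (G.obj (K.X n))) :
    (mapResolution G π hK).π.f 0 = G.map (π.f 0) := by
  have h : ((HomologicalComplex.singleMapHomologicalComplex G (.down ℕ) 0).hom.app X).f 0 =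
      𝟙 (G.obj X) := rfl
  exact (congrArg (G.map (π.f 0) ≫ ·) h).trans (Category.comp_id _)

lemma mapHomologicalComplex_app_comp_π {G H : A ⥤ C} [G.Additive] [G.PreservesHomology]
    [H.Additive] [H.PreservesHomology] (η : G ⟶ H) {K : ChainComplex A ℕ} {X : A}
    (π : K ⟶ (ChainComplex.single₀ A).obj X) [QuasiIso π]
    (hG : ∀ n, Projective (G.obj (K.X n))) (hH : ∀ n, Projective (H.obj (K.X n))) :
    ((NatTrans.mapHomologicalComplex η (.down ℕ)).app K).f 0 ≫ (mapResolution H π hH).π.f 0 =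
      (mapResolution G π hG).π.f 0 ≫ η.app X := by
  rw [mapResolution_π_f_zero, mapResolution_π_f_zero]
  exact (η.naturality (π.f 0)).symm

instance : (ShortComplex.π₁ : ShortComplex C ⥤ C).Additive where

instance : (ShortComplex.π₂ : ShortComplex C ⥤ C).Additive where

instance : (ShortComplex.π₃ : ShortComplex C ⥤ C).Additive where

end Map

section LeftDerived

open Limits

variable {C : Type*} [Category* C] [Abelian C] [EnoughProjectives C]
  {D : Type*} [Category* D] [Abelian D]

instance leftDerived_additive {C : Type*} [Category* C] [Abelian C] [HasProjectiveResolutions C]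
    {D : Type*} [Category* D] [Abelian D] (F : C ⥤ D) [F.Additive] (n : ℕ) :
    (F.leftDerived n).Additive where
  map_add {X Y f g} := by
    let P := Classical.choice (HasProjectiveResolutions.out X).out
    let Q := Classical.choice (HasProjectiveResolutions.out Y).out
    have hw : (ProjectiveResolution.lift f P Q + ProjectiveResolution.lift g P Q) ≫ Q.π =
        P.π ≫ (ChainComplex.single₀ _).map (f + g) := by
      rw [Preadditive.add_comp, ProjectiveResolution.lift_commutes,
        ProjectiveResolution.lift_commutes, Functor.map_add, Preadditive.comp_add]
    rw [F.leftDerived_map_eq n (f + g) _ hw,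
      F.leftDerived_map_eq n f _ (ProjectiveResolution.lift_commutes f P Q),
      F.leftDerived_map_eq n g _ (ProjectiveResolution.lift_commutes g P Q),
      Functor.map_add, Preadditive.add_comp, Preadditive.comp_add]

theorem exists_shortExact_homology_iso_leftDerived (F : C ⥤ D) [F.Additive] {S : ShortComplex C}
    (hS : S.ShortExact) :
    ∃ T : ShortComplex (ChainComplex D ℕ), T.ShortExact ∧
      ∀ n, Nonempty (S.map (F.leftDerived n) ≅
        T.map (HomologicalComplex.homologyFunctor D (.down ℕ) n)) := by
  obtain ⟨K, π, hK, _⟩ := exists_quasiIso_single₀_of_exists_epi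
    (P := IsProjectiveShortExact) (W := fun S : ShortComplex C => S.ShortExact)
    (fun _ => exists_epi_of_isProjectiveShortExact) hS
  let P₁ := mapResolution ShortComplex.π₁ π fun n => (hK n).2.1
  let P₂ := mapResolution ShortComplex.π₂ π fun n => (hK n).2.2.1
  let P₃ := mapResolution ShortComplex.π₃ π fun n => (hK n).2.2.2
  let f : P₁.complex ⟶ P₂.complex := (NatTrans.mapHomologicalComplex ShortComplex.π₁Toπ₂ _).app K
  let g : P₂.complex ⟶ P₃.complex := (NatTrans.mapHomologicalComplex ShortComplex.π₂Toπ₃ _).app K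
  let T : ShortComplex (ChainComplex D ℕ) :=
    ShortComplex.mk ((F.mapHomologicalComplex _).map f) ((F.mapHomologicalComplex _).map g) (by
      ext n
      exact ((K.X n).map F).zero)
  refine ⟨T, HomologicalComplex.shortExact_of_degreewise_shortExact T fun n => ?_, fun n => ?_⟩
  · have := (hK n).2.2.2
    exact ((hK n).1.splittingOfProjective.map F).shortExact
  · exact ⟨ShortComplex.isoMk (P₁.isoLeftDerivedObj F n) (P₂.isoLeftDerivedObj F n)
      (P₃.isoLeftDerivedObj F n)
      (P₁.isoLeftDerivedObj_hom_naturality S.f P₂ f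
        (mapHomologicalComplex_app_comp_π ShortComplex.π₁Toπ₂ π _ _) F n).symm
      (P₂.isoLeftDerivedObj_hom_naturality S.g P₃ g
        (mapHomologicalComplex_app_comp_π ShortComplex.π₂Toπ₃ π _ _) F n).symm⟩

lemma isIso_homologyMap_g_zero {T : ShortComplex (ChainComplex D ℕ)} (hT : T.ShortExact)
    (h : HomologicalComplex.homologyMap T.f 0 = 0) :
    IsIso (HomologicalComplex.homologyMap T.g 0) := by
  have := hT.epi_g
  have : Mono (HomologicalComplex.homologyMap T.g 0) :=
    (ShortComplex.exact_iff_mono _ h).1 (hT.homology_exact₂ 0)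
  have : Epi (HomologicalComplex.homologyMap T.g 0) := by
    rw [(Iso.inv_comp_eq _).1 (ChainComplex.isoHomologyι₀_inv_naturality T.g)]
    infer_instance
  exact isIso_of_mono_of_epi _

lemma shortExact_homologyMap_g_δ {T : ShortComplex (ChainComplex D ℕ)} (hT : T.ShortExact)
    (h : ∀ n, HomologicalComplex.homologyMap T.f n = 0) {i j : ℕ}
    (hij : (ComplexShape.down ℕ).Rel i j) :
    (ShortComplex.mk _ _ (hT.comp_δ i j hij)).ShortExact where
  exact := hT.homology_exact₃ i j hij
  mono_f := (ShortComplex.exact_iff_mono _ (h i)).1 (hT.homology_exact₂ i)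
  epi_g := (ShortComplex.exact_iff_epi _ (h j)).1 (hT.homology_exact₁ i j hij)

theorem exists_leftDerived_shortExact_of_map_f_eq_zero (F : C ⥤ D) [F.Additive]
    {S : ShortComplex C} (hS : S.ShortExact) (h : ∀ n, (F.leftDerived n).map S.f = 0) :
    IsIso ((F.leftDerived 0).map S.g) ∧
      ∀ n, ∃ (δ : (F.leftDerived (n + 1)).obj S.X₃ ⟶ (F.leftDerived n).obj S.X₁)
        (w : (F.leftDerived (n + 1)).map S.g ≫ δ = 0), (ShortComplex.mk _ _ w).ShortExact := by
  obtain ⟨T, hT, hiso⟩ := exists_shortExact_homology_iso_leftDerived F hS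
  let x (n : ℕ) : (F.leftDerived n).obj S.X₁ ≅ T.X₁.homology n :=
    ShortComplex.π₁.mapIso (hiso n).some
  let y (n : ℕ) : (F.leftDerived n).obj S.X₂ ≅ T.X₂.homology n :=
    ShortComplex.π₂.mapIso (hiso n).some
  let z (n : ℕ) : (F.leftDerived n).obj S.X₃ ≅ T.X₃.homology n :=
    ShortComplex.π₃.mapIso (hiso n).some
  have hSf (n : ℕ) : (x n).hom ≫ HomologicalComplex.homologyMap T.f n =
      (F.leftDerived n).map S.f ≫ (y n).hom := (hiso n).some.hom.comm₁₂
  have hSg (n : ℕ) : (y n).hom ≫ HomologicalComplex.homologyMap T.g n =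
      (F.leftDerived n).map S.g ≫ (z n).hom := (hiso n).some.hom.comm₂₃
  have hTf (n : ℕ) : HomologicalComplex.homologyMap T.f n = 0 :=
    zero_of_epi_comp (x n).hom (by rw [hSf, h, zero_comp])
  refine ⟨?_, fun n => ?_⟩
  · have := isIso_homologyMap_g_zero hT (hTf 0)
    rw [← (Iso.comp_inv_eq _).2 (hSg 0)]
    infer_instance
  · have hij : (ComplexShape.down ℕ).Rel (n + 1) n := ComplexShape.down_mk _ _ rfl
    have w : (F.leftDerived (n + 1)).map S.g ≫
        (z (n + 1)).hom ≫ hT.δ (n + 1) n hij ≫ (x n).inv = 0 := by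
      rw [← reassoc_of% (hSg (n + 1)), reassoc_of% (hT.comp_δ (n + 1) n hij), zero_comp, comp_zero]
    let φ : ShortComplex.mk _ _ w ≅ ShortComplex.mk _ _ (hT.comp_δ (n + 1) n hij) :=
      ShortComplex.isoMk (y (n + 1)) (z (n + 1)) (x n) (hSg (n + 1)) (by simp)
    exact ⟨_, w, ShortComplex.shortExact_of_iso φ.symm (shortExact_homologyMap_g_δ hT hTf hij)⟩

end LeftDerived

section SpanSingletonMul

variable {R : Type*} [CommRing R] [IsDomain R]

/-- Multiplication by a nonzero element `a` of a domain, as an isomorphism from an ideal `I` onto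
`(a) I`. -/
noncomputable def spanSingletonMulEquiv {a : R} (ha : a ≠ 0) (I : Ideal R) :
    I ≃ₗ[R] ↥(Ideal.span {a} * I) :=
  Submodule.equivMapOfInjective (LinearMap.mulLeft R a) (mul_right_injective₀ ha) I ≪≫ₗ
    LinearEquiv.ofEq _ _ (by
      ext
      simp [Ideal.mem_span_singleton_mul])

lemma coe_spanSingletonMulEquiv {a : R} (ha : a ≠ 0) (I : Ideal R) (b : I) :
    (spanSingletonMulEquiv ha I b : R) = a * b :=
  rfl

lemma exists_smul_eq_inclusion {a : R} (ha : a ≠ 0) {I J : Ideal R} (h : J ≤ Ideal.span {a} * I) :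
    ∃ φ : J →ₗ[R] I, a • φ = Submodule.inclusion (h.trans Ideal.mul_le_right) := by
  refine ⟨(spanSingletonMulEquiv ha I).symm ∘ₗ Submodule.inclusion h, ?_⟩
  ext b
  simp [← coe_spanSingletonMulEquiv ha]

end SpanSingletonMul

section MayerVietoris

variable {R M : Type*} [Ring R] [AddCommGroup M] [Module R M]

/-- The diagonal inclusion of an intersection of submodules in their product, the first map of the
Mayer–Vietoris sequence `0 → A ⊓ B → A × B → A ⊔ B → 0`. -/
def infToProd (A B : Submodule R M) : ↥(A ⊓ B) →ₗ[R] A × B :=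
  (Submodule.inclusion inf_le_left).prod (Submodule.inclusion inf_le_right)

/-- The difference map `(a, b) ↦ a - b`, the second map of the Mayer–Vietoris sequence
`0 → A ⊓ B → A × B → A ⊔ B → 0`. -/
def prodToSup (A B : Submodule R M) : A × B →ₗ[R] ↥(A ⊔ B) :=
  (Submodule.inclusion le_sup_left).coprod (-Submodule.inclusion le_sup_right)

lemma infToProd_injective (A B : Submodule R M) : Function.Injective (infToProd A B) :=
  fun _ _ h => Subtype.ext congr(($h).1)

lemma prodToSup_surjective (A B : Submodule R M) : Function.Surjective (prodToSup A B) := by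
  rintro ⟨_, h⟩
  obtain ⟨a, ha, b, hb, rfl⟩ := Submodule.mem_sup.1 h
  exact ⟨(⟨a, ha⟩, ⟨-b, neg_mem hb⟩), by simp [prodToSup, Subtype.ext_iff]⟩

lemma exact_infToProd_prodToSup (A B : Submodule R M) :
    Function.Exact (infToProd A B) (prodToSup A B) := by
  rintro ⟨⟨a, ha⟩, ⟨b, hb⟩⟩
  constructor
  · intro h
    have hab : a - b = 0 := by simpa [prodToSup, sub_eq_add_neg] using congr(($h : M))
    obtain rfl := sub_eq_zero.1 hab
    exact ⟨⟨a, ha, hb⟩, rfl⟩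
  · rintro ⟨c, hc⟩
    simp [← hc, infToProd, prodToSup, Subtype.ext_iff]

end MayerVietoris

section Tor

open Limits MonoidalCategory

lemma leftDerived_map_smul_eq_zero {R : Type*} [CommRing R] {C : Type*} [Category* C] [Abelian C]
    [EnoughProjectives C] [Linear R C] {D : Type*} [Category* D] [Abelian D] (F : C ⥤ D)
    [F.Additive] {r : R} (hr : ∀ {X Y : C} (f : X ⟶ Y), F.map (r • f) = 0) {X Y : C} (φ : X ⟶ Y)
    (i : ℕ) : (F.leftDerived i).map (r • φ) = 0 := by
  let P := ProjectiveResolution.of X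
  let Q := ProjectiveResolution.of Y
  have hlift : (r • ProjectiveResolution.lift φ P Q).f 0 ≫ Q.π.f 0 = P.π.f 0 ≫ (r • φ) := by
    rw [HomologicalComplex.smul_f_apply, Linear.smul_comp,
      ProjectiveResolution.lift_commutes_zero]
    exact (Linear.comp_smul _ _ _ (P.π.f 0) r φ).symm
  have hzero : (F.mapHomologicalComplex (.down ℕ)).map (r • ProjectiveResolution.lift φ P Q) = 0 :=
    HomologicalComplex.hom_ext _ _ fun n => hr ((ProjectiveResolution.lift φ P Q).f n)
  have h := P.isoLeftDerivedObj_hom_naturality (r • φ) Q _ hlift F i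
  rw [Functor.comp_map, hzero, Functor.map_zero, comp_zero] at h
  exact zero_of_comp_mono (Q.isoLeftDerivedObj F i).hom h

lemma tensoringLeft_map_smul_eq_zero {R : Type u} [CommRing R] {X : ModuleCat.{u} R} {r : R}
    (hr : ∀ x : X, r • x = 0) {M N : ModuleCat.{u} R} (f : M ⟶ N) :
    ((tensoringLeft (ModuleCat.{u} R)).obj X).map (r • f) = 0 := by
  refine ModuleCat.MonoidalCategory.tensor_ext fun (x : X) (m : M) => ?_
  change x ⊗ₜ[R] (r • f.hom m) = 0
  rw [← TensorProduct.smul_tmul, hr, TensorProduct.zero_tmul]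

lemma tor_map_smul_eq_zero {R : Type u} [CommRing R] {X : ModuleCat.{u} R} {r : R}
    (hr : ∀ x : X, r • x = 0) {M N : ModuleCat.{u} R} (f : M ⟶ N) (i : ℕ) :
    (((tensoringLeft (ModuleCat.{u} R)).obj X).leftDerived i).map (r • f) = 0 :=
  leftDerived_map_smul_eq_zero (R := R) (C := ModuleCat R) (D := ModuleCat R) (r := r) _
    (tensoringLeft_map_smul_eq_zero hr) f i

end Tor

section BettiNumber

open Limits MonoidalCategory MvPolynomial

variable {K : Type u} [Field K] {n : ℕ}

/-- The residue field `K` of `K[x_1, …, x_n]` at the origin, the module in `torResidueField`. -/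
noncomputable abbrev residueField (K : Type u) [Field K] (n : ℕ) :
    ModuleCat.{u} (MvPolynomial (Fin n) K) :=
  ModuleCat.of _ (MvPolynomial (Fin n) K ⧸ idealOfVars (Fin n) K)

/-- `Tor_i(k, -)` as a functor from modules over `K[x_1, …, x_n]` to vector spaces over `K`, so that
`bettiNumber K n M i` is the dimension of its value at `M`. -/
noncomputable abbrev torFunctor (K : Type u) [Field K] (n i : ℕ) :
    ModuleCat.{u} (MvPolynomial (Fin n) K) ⥤ ModuleCat.{u} K :=
  ((tensoringLeft _).obj (residueField K n)).leftDerived i ⋙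
    ModuleCat.restrictScalars (algebraMap K (MvPolynomial (Fin n) K))

lemma X_smul_residueField (j : Fin n) (w : residueField K n) :
    (X j : MvPolynomial (Fin n) K) • w = 0 := by
  obtain ⟨a, rfl⟩ := Ideal.Quotient.mk_surjective w
  exact Ideal.Quotient.eq_zero_iff_mem.2 (Ideal.mul_mem_right a _ (Ideal.subset_span ⟨j, rfl⟩))

lemma torFunctor_map_smul_eq_zero (j : Fin n) {M N : ModuleCat.{u} (MvPolynomial (Fin n) K)}
    (f : M ⟶ N) (i : ℕ) :
    (torFunctor K n i).map ((X j : MvPolynomial (Fin n) K) • f) = 0 := by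
  have h := tor_map_smul_eq_zero (X_smul_residueField (K := K) j) f i
  exact (congrArg (ModuleCat.restrictScalars _).map h).trans (Functor.map_zero _ _ _)

variable {M N : Type u} [AddCommGroup M] [Module (MvPolynomial (Fin n) K) M]
  [AddCommGroup N] [Module (MvPolynomial (Fin n) K) N]

lemma bettiNumber_congr (e : M ≃ₗ[MvPolynomial (Fin n) K] N) (i : ℕ) :
    bettiNumber K n M i = bettiNumber K n N i :=
  ((torFunctor K n i).mapIso e.toModuleIso).toLinearEquiv.rank_eq

lemma bettiNumber_prod (i : ℕ) :
    bettiNumber K n (M × N) i = bettiNumber K n M i + bettiNumber K n N i := by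
  let T := torFunctor K n i
  have : T.Additive := inferInstanceAs (torFunctor K n i).Additive
  have := preservesBinaryBiproducts_of_preservesBiproducts T
  let e : T.obj (ModuleCat.of _ (M × N)) ≅ ModuleCat.of K
      (T.obj (ModuleCat.of _ M) × T.obj (ModuleCat.of _ N)) :=
    T.mapIso (ModuleCat.biprodIsoProd (ModuleCat.of _ M) (ModuleCat.of _ N)).symm ≪≫
      T.mapBiprod _ _ ≪≫ ModuleCat.biprodIsoProd _ _
  exact e.toLinearEquiv.rank_eq.trans rank_prod'

lemma bettiNumber_self_succ (i : ℕ) : bettiNumber K n (MvPolynomial (Fin n) K) (i + 1) = 0 := by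
  let R : ModuleCat (MvPolynomial (Fin n) K) := ModuleCat.of _ (MvPolynomial (Fin n) K)
  have : Projective R := inferInstance
  have h := (ModuleCat.restrictScalars (algebraMap K (MvPolynomial (Fin n) K))).map_isZero
    (isZero_Tor_succ_of_projective _ (residueField K n) R i)
  exact @rank_subsingleton' _ _ _ _ _ _ (ModuleCat.subsingleton_of_isZero h)

lemma ker_constantCoeff {σ R : Type*} [CommRing R] :
    RingHom.ker (constantCoeff : MvPolynomial σ R →+* R) = idealOfVars σ R := by
  ext f
  rw [← pow_one (idealOfVars σ R), mem_pow_idealOfVars_iff', RingHom.mem_ker, constantCoeff_eq]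
  simp [Finsupp.degree_eq_zero_iff]

lemma rank_residueField : Module.rank K ((ModuleCat.restrictScalars
    (algebraMap K (MvPolynomial (Fin n) K))).obj (residueField K n)) = 1 := by
  refine rank_eq_one (M := (ModuleCat.restrictScalars _).obj (residueField K n))
    (Ideal.Quotient.mk (idealOfVars (Fin n) K) 1) ?_ fun w => ?_
  · intro h
    have h' := Ideal.Quotient.eq_zero_iff_mem.1 h
    rw [← ker_constantCoeff] at h'
    simp at h'
  · obtain ⟨f, rfl⟩ := Ideal.Quotient.mk_surjective (I := idealOfVars (Fin n) K) w
    refine ⟨constantCoeff f, ?_⟩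
    change Ideal.Quotient.mk _ (C (constantCoeff f) * 1) = _
    rw [Ideal.Quotient.eq, ← ker_constantCoeff]
    simp

lemma bettiNumber_self_zero : bettiNumber K n (MvPolynomial (Fin n) K) 0 = 1 := by
  let R : ModuleCat (MvPolynomial (Fin n) K) := ModuleCat.of _ (MvPolynomial (Fin n) K)
  have : Projective R := inferInstance
  let F := (tensoringLeft (ModuleCat (MvPolynomial (Fin n) K))).obj (residueField K n)
  let e : (F.leftDerived 0).obj R ≅ residueField K n :=
    asIso (F.fromLeftDerivedZero.app R) ≪≫ ρ_ (residueField K n)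
  exact ((ModuleCat.restrictScalars _).mapIso e).toLinearEquiv.rank_eq.trans rank_residueField

lemma rank_eq_add_of_shortExact {T : ShortComplex (ModuleCat.{u} K)} (hT : T.ShortExact) :
    Module.rank K T.X₂ = Module.rank K T.X₁ + Module.rank K T.X₃ := by
  rw [← LinearMap.rank_range_add_rank_ker T.g.hom, ← hT.exact.moduleCat_range_eq_ker,
    LinearMap.range_eq_top.2 hT.moduleCat_surjective_g, rank_top,
    rank_range_of_injective _ hT.moduleCat_injective_f, add_comm]

theorem bettiNumber_of_torFunctor_map_eq_zero {L : Type u} [AddCommGroup L]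
    [Module (MvPolynomial (Fin n) K) L] {f : L →ₗ[MvPolynomial (Fin n) K] M}
    {g : M →ₗ[MvPolynomial (Fin n) K] N} (hf : Function.Injective f) (hg : Function.Surjective g)
    (hfg : Function.Exact f g) (h : ∀ i, (torFunctor K n i).map (ModuleCat.ofHom f) = 0) :
    bettiNumber K n N 0 = bettiNumber K n M 0 ∧
      ∀ i, bettiNumber K n N (i + 1) = bettiNumber K n M (i + 1) + bettiNumber K n L i := by
  let F := (tensoringLeft (ModuleCat (MvPolynomial (Fin n) K))).obj (residueField K n)
  let G := ModuleCat.restrictScalars.{u} (algebraMap K (MvPolynomial (Fin n) K))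
  let T := ShortComplex.mk (ModuleCat.ofHom f) (ModuleCat.ofHom g)
    (ModuleCat.hom_ext hfg.linearMap_comp_eq_zero)
  have hT : T.ShortExact := ModuleCat.shortComplex_shortExact T hfg hf hg
  obtain ⟨h₀, hsucc⟩ := exists_leftDerived_shortExact_of_map_f_eq_zero F hT fun i =>
    G.map_injective ((h i).trans (G.map_zero _ _).symm)
  refine ⟨?_, fun i => ?_⟩
  · exact (G.mapIso (asIso ((F.leftDerived 0).map T.g))).toLinearEquiv.rank_eq.symm
  · obtain ⟨δ, w, hδ⟩ := hsucc i
    exact rank_eq_add_of_shortExact (hδ.map_of_exact G)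

theorem bettiNumber_sup {A B : Ideal (MvPolynomial (Fin n) K)} {j k : Fin n}
    (hA : A ⊓ B ≤ Ideal.span {X j} * A) (hB : A ⊓ B ≤ Ideal.span {X k} * B) :
    bettiNumber K n ↥(A ⊔ B) 0 = bettiNumber K n A 0 + bettiNumber K n B 0 ∧
      ∀ i, bettiNumber K n ↥(A ⊔ B) (i + 1) = bettiNumber K n A (i + 1) +
        bettiNumber K n B (i + 1) + bettiNumber K n ↥(A ⊓ B) i := by
  have hzero (i : ℕ) : (torFunctor K n i).map (ModuleCat.ofHom (infToProd A B)) = 0 := by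
    obtain ⟨φ, hφ⟩ := exists_smul_eq_inclusion (X_ne_zero j) hA
    obtain ⟨ψ, hψ⟩ := exists_smul_eq_inclusion (X_ne_zero k) hB
    have hsum : ModuleCat.ofHom (infToProd A B) =
        (X j : MvPolynomial (Fin n) K) •
          ModuleCat.ofHom (LinearMap.inl (MvPolynomial (Fin n) K) A B ∘ₗ φ) +
        (X k : MvPolynomial (Fin n) K) •
          ModuleCat.ofHom (LinearMap.inr (MvPolynomial (Fin n) K) A B ∘ₗ ψ) := by
      refine ModuleCat.hom_ext (LinearMap.ext fun a => Prod.ext ?_ ?_)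
      · simpa [infToProd] using congr($hφ a).symm
      · simpa [infToProd] using congr($hψ a).symm
    rw [hsum, Functor.map_add, torFunctor_map_smul_eq_zero, torFunctor_map_smul_eq_zero, add_zero]
  simp only [← bettiNumber_prod]
  exact bettiNumber_of_torFunctor_map_eq_zero (infToProd_injective A B)
    (prodToSup_surjective A B) (exact_infToProd_prodToSup A B) hzero

end BettiNumber

section IdealPower

variable {R : Type*} [CommSemiring R]

lemma ideal_sup_pow_succ (A B : Ideal R) (t : ℕ) :
    (A ⊔ B) ^ (t + 1) = A ^ (t + 1) ⊔ B * (A ⊔ B) ^ t := by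
  induction t with
  | zero => simp
  | succ t ih =>
    have hAB : A * (B * (A ⊔ B) ^ t) ≤ B * (A ⊔ B) ^ (t + 1) := by
      rw [mul_left_comm, pow_succ' (A ⊔ B)]
      gcongr
      exact le_sup_left
    calc (A ⊔ B) ^ (t + 1 + 1)
        = A * (A ⊔ B) ^ (t + 1) ⊔ B * (A ⊔ B) ^ (t + 1) := by rw [pow_succ', Ideal.sup_mul]
      _ = A ^ (t + 1 + 1) ⊔ (A * (B * (A ⊔ B) ^ t) ⊔ B * (A ⊔ B) ^ (t + 1)) := by
        conv_lhs => enter [1]; rw [ih, Ideal.mul_sup, ← pow_succ']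
        rw [sup_assoc]
      _ = A ^ (t + 1 + 1) ⊔ B * (A ⊔ B) ^ (t + 1) := by rw [sup_eq_right.2 hAB]

lemma mem_of_pow_mul_mem {M : Type*} [Monoid M] {s : Set M} {y : M}
    (hs : ∀ a, y * a ∈ s → a ∈ s) (m : ℕ) {a : M} (h : y ^ m * a ∈ s) : a ∈ s := by
  induction m with
  | zero => simpa using h
  | succ m ih => exact ih (hs _ (by rwa [pow_succ', mul_assoc] at h))

variable {I : Ideal R} {y p : R} {t : ℕ}

lemma span_pow_mul_mul_pow_le {x g : R} (hg : g ∈ I) :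
    Ideal.span {y ^ (t + 1) * (x * g)} * I ^ t ≤
      Ideal.span {x} * (Ideal.span {y} * I) ^ (t + 1) := by
  have hgI : Ideal.span {g} ≤ I := (Ideal.span_singleton_le_iff_mem I).2 hg
  calc Ideal.span {y ^ (t + 1) * (x * g)} * I ^ t
      = Ideal.span {x} * (Ideal.span {y} ^ (t + 1) * (Ideal.span {g} * I ^ t)) := by
        simp only [← Ideal.span_singleton_mul_span_singleton, ← Ideal.span_singleton_pow]
        ring
    _ ≤ Ideal.span {x} * (Ideal.span {y} * I) ^ (t + 1) := by
        rw [mul_pow, pow_succ' I]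
        gcongr

lemma span_pow_mul_pow_le :
    Ideal.span {y ^ (t + 1) * p} * I ^ t ≤
      Ideal.span {y} * (Ideal.span {p} * (Ideal.span {y} * I ⊔ Ideal.span {p}) ^ t) := by
  calc Ideal.span {y ^ (t + 1) * p} * I ^ t
      = Ideal.span {y} * (Ideal.span {p} * (Ideal.span {y} * I) ^ t) := by
        rw [← Ideal.span_singleton_mul_span_singleton, ← Ideal.span_singleton_pow]
        ring
    _ ≤ Ideal.span {y} * (Ideal.span {p} * (Ideal.span {y} * I ⊔ Ideal.span {p}) ^ t) := by
        gcongr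
        exact le_sup_left

lemma span_singleton_mul_pow_inf_eq [IsDomain R] (hy : Prime y) (hyp : ¬ y ∣ p) (hp : p ∈ I)
    (hI : ∀ a, y * a ∈ I ^ t → a ∈ I ^ t) :
    (Ideal.span {y} * I) ^ (t + 1) ⊓ Ideal.span {p} * (Ideal.span {y} * I ⊔ Ideal.span {p}) ^ t =
      Ideal.span {y ^ (t + 1) * p} * I ^ t := by
  have hpI : Ideal.span {p} ≤ I := (Ideal.span_singleton_le_iff_mem I).2 hp
  refine le_antisymm (fun c hc => ?_) (le_inf ?_ ?_)
  · rw [mul_pow, Ideal.span_singleton_pow] at hc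
    obtain ⟨hcA, hcB⟩ := hc
    obtain ⟨a, -, rfl⟩ := Ideal.mem_span_singleton_mul.1 hcA
    obtain ⟨b, hb, hbc⟩ := Ideal.mem_span_singleton_mul.1 hcB
    obtain ⟨d, rfl⟩ : y ^ (t + 1) ∣ b :=
      hy.pow_dvd_of_dvd_mul_left _ hyp ⟨a, hbc⟩
    have hd : y ^ (t + 1) * d ∈ I ^ t :=
      Ideal.pow_right_mono (sup_le Ideal.mul_le_right hpI) t hb
    exact Ideal.mem_span_singleton_mul.2 ⟨d, mem_of_pow_mul_mem hI _ hd, by rw [← hbc]; ring⟩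
  · rw [← Ideal.span_singleton_mul_span_singleton, ← Ideal.span_singleton_pow, mul_pow, mul_assoc,
      pow_succ' I]
    gcongr
  · exact span_pow_mul_pow_le.trans Ideal.mul_le_right

end IdealPower

section Recursion

open MvPolynomial

variable {K : Type u} [Field K] {n : ℕ}

theorem bettiNumber_pow_succ_of_eq_sup {I L : Ideal (MvPolynomial (Fin n) K)} {j k : Fin n}
    {g : MvPolynomial (Fin n) K} (hg : g ∈ I) (hk : ¬ X k ∣ X j * g) {t : ℕ}
    (hI : ∀ a, X k * a ∈ I ^ t → a ∈ I ^ t)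
    (hL : L = Ideal.span {X k} * I ⊔ Ideal.span {X j * g}) :
    bettiNumber K n ↥(L ^ (t + 1)) 0 =
        bettiNumber K n ↥(I ^ (t + 1)) 0 + bettiNumber K n ↥(L ^ t) 0 ∧
      ∀ i, bettiNumber K n ↥(L ^ (t + 1)) (i + 1) = bettiNumber K n ↥(I ^ (t + 1)) (i + 1) +
        bettiNumber K n ↥(L ^ t) (i + 1) + bettiNumber K n ↥(I ^ t) i := by
  have hp : X j * g ≠ 0 := fun h => hk (h ▸ dvd_zero _)
  have hy : (X k ^ (t + 1) : MvPolynomial (Fin n) K) ≠ 0 := pow_ne_zero _ (X_ne_zero k)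
  have hinf := span_singleton_mul_pow_inf_eq X_prime hk (I.mul_mem_left (X j) hg) hI
  have h := bettiNumber_sup (hinf.trans_le (span_pow_mul_mul_pow_le hg))
    (hinf.trans_le span_pow_mul_pow_le)
  rw [← ideal_sup_pow_succ, hinf, mul_pow, Ideal.span_singleton_pow, ← hL] at h
  simpa only [← bettiNumber_congr (spanSingletonMulEquiv hy _),
    ← bettiNumber_congr (spanSingletonMulEquiv hp _),
    ← bettiNumber_congr (spanSingletonMulEquiv (mul_ne_zero hy hp) _)] using h

end Recursion

section MonomialsAvoiding

open MvPolynomial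
open scoped Pointwise

variable {σ R : Type*} [CommSemiring R]

/-- The monic monomials in which the variable `X k` does not occur, used to express that an ideal is
generated by monomials not involving `X k`. -/
noncomputable def monomialsAvoiding (R : Type*) [CommSemiring R] (k : σ) :
    Submonoid (MvPolynomial σ R) :=
  Submonoid.closure (X '' {k}ᶜ)

lemma X_mem_monomialsAvoiding {i k : σ} (h : i ≠ k) :
    (X i : MvPolynomial σ R) ∈ monomialsAvoiding R k :=
  Submonoid.subset_closure ⟨i, h, rfl⟩

lemma exists_eq_monomial_of_mem_monomialsAvoiding {k : σ} {m : MvPolynomial σ R}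
    (hm : m ∈ monomialsAvoiding R k) : ∃ d : σ →₀ ℕ, d k = 0 ∧ m = monomial d 1 := by
  induction hm using Submonoid.closure_induction with
  | mem _ h =>
    obtain ⟨i, hi, rfl⟩ := h
    exact ⟨Finsupp.single i 1, Finsupp.single_eq_of_ne' hi, rfl⟩
  | one => exact ⟨0, rfl, rfl⟩
  | mul _ _ _ _ ih₁ ih₂ =>
    obtain ⟨d, hd, rfl⟩ := ih₁
    obtain ⟨e, he, rfl⟩ := ih₂
    exact ⟨d + e, by simp [hd, he], by rw [monomial_mul, one_mul]⟩

lemma not_X_dvd_of_mem_monomialsAvoiding [Nontrivial R] {k : σ} {m : MvPolynomial σ R}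
    (hm : m ∈ monomialsAvoiding R k) : ¬ X k ∣ m := by
  obtain ⟨d, hd, rfl⟩ := exists_eq_monomial_of_mem_monomialsAvoiding hm
  simp [X_dvd_monomial, hd]

lemma mem_span_of_X_mul_mem_span {k : σ} {G : Set (MvPolynomial σ R)}
    (hG : G ⊆ monomialsAvoiding R k) {f : MvPolynomial σ R} (h : X k * f ∈ Ideal.span G) :
    f ∈ Ideal.span G := by
  obtain ⟨D, hD, rfl⟩ : ∃ D : Set (σ →₀ ℕ), (∀ d ∈ D, d k = 0) ∧ (monomial · 1) '' D = G := by
    refine ⟨{d | d k = 0 ∧ monomial d 1 ∈ G}, fun d hd => hd.1, Set.Subset.antisymm ?_ ?_⟩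
    · rintro _ ⟨d, hd, rfl⟩
      exact hd.2
    · intro m hm
      obtain ⟨d, hd, rfl⟩ := exists_eq_monomial_of_mem_monomialsAvoiding (hG hm)
      exact ⟨d, ⟨hd, hm⟩, rfl⟩
  rw [mem_ideal_span_monomial_image] at h ⊢
  intro e he
  obtain ⟨d, hdD, hde⟩ := h (Finsupp.single k 1 + e) (by simpa [support_X_mul] using he)
  refine ⟨d, hdD, fun i => ?_⟩
  rcases eq_or_ne i k with rfl | hi
  · simp [hD d hdD]
  · simpa [Finsupp.single_eq_of_ne hi] using hde i

lemma mem_span_pow_of_X_mul_mem_span_pow {k : σ} {G : Set (MvPolynomial σ R)}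
    (hG : G ⊆ monomialsAvoiding R k) {t : ℕ} {f : MvPolynomial σ R}
    (h : X k * f ∈ Ideal.span G ^ t) : f ∈ Ideal.span G ^ t := by
  rw [Ideal.span, Submodule.span_pow] at h ⊢
  exact mem_span_of_X_mul_mem_span (Submonoid.pow_subset hG) h

end MonomialsAvoiding

section EdgeComplement

/-- The product of the variables `v 0, …, v (q + 1)` other than `v j` and `v (j + 1)`, that is, the
monomial of the complement of the `j`-th edge of the path on `q + 2` vertices. -/
def edgeComplementProd {M : Type*} [CommMonoid M] (v : ℕ → M) (q j : ℕ) : M :=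
  (∏ i ∈ Finset.range j, v i) * ∏ i ∈ Finset.Ico (j + 2) (q + 2), v i

lemma edgeComplementProd_self {M : Type*} [CommMonoid M] (v : ℕ → M) (q : ℕ) :
    edgeComplementProd v q q = ∏ i ∈ Finset.range q, v i := by
  simp [edgeComplementProd]

lemma edgeComplementProd_succ {M : Type*} [CommMonoid M] (v : ℕ → M) {q j : ℕ} (h : j ≤ q) :
    edgeComplementProd v (q + 1) j = v (q + 2) * edgeComplementProd v q j := by
  rw [edgeComplementProd, edgeComplementProd, Finset.prod_Ico_succ_top (by omega)]
  ac_rfl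

variable {R : Type*} [CommSemiring R]

/-- The ideal generated by the products over the complements of the `q + 1` edges of the path on the
vertices `0, …, q + 1`. For `q = n - 2` it is `truncatedCyclePathIdeal`: the `n`-cycle without the
edge `{n, 1}`, whose complement is the omitted generator, is a path. -/
def edgeComplementIdeal (v : ℕ → R) (q : ℕ) : Ideal R :=
  Ideal.span (edgeComplementProd v q '' Set.Iic q)

lemma prod_range_mem_edgeComplementIdeal (v : ℕ → R) (q : ℕ) :
    ∏ i ∈ Finset.range q, v i ∈ edgeComplementIdeal v q :=
  Ideal.subset_span ⟨q, Set.mem_Iic.2 le_rfl, edgeComplementProd_self v q⟩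

lemma edgeComplementIdeal_zero (v : ℕ → R) : edgeComplementIdeal v 0 = 1 := by
  rw [Ideal.one_eq_top, Ideal.eq_top_iff_one]
  exact prod_range_mem_edgeComplementIdeal v 0

lemma edgeComplementIdeal_succ (v : ℕ → R) (q : ℕ) :
    edgeComplementIdeal v (q + 1) = Ideal.span {v (q + 2)} * edgeComplementIdeal v q ⊔
      Ideal.span {v q * ∏ i ∈ Finset.range q, v i} := by
  have hIic : Set.Iic (q + 1) = insert (q + 1) (Set.Iic q) := Order.Iic_succ q
  rw [edgeComplementIdeal, edgeComplementIdeal, hIic, Set.image_insert_eq, Ideal.span_insert,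
    sup_comm, edgeComplementProd_self, Finset.prod_range_succ_comm, Ideal.span_mul_span',
    Set.singleton_mul, Set.image_image]
  congr 2
  exact Set.image_congr fun j hj => edgeComplementProd_succ v hj

open MvPolynomial

lemma edgeComplementProd_X_mem_monomialsAvoiding {σ : Type*} {s : ℕ → σ} {q j : ℕ} {k : σ}
    (hs : ∀ i < q + 2, s i ≠ k) (hj : j ≤ q) :
    edgeComplementProd (fun i => (X (s i) : MvPolynomial σ R)) q j ∈ monomialsAvoiding R k := by
  refine mul_mem (prod_mem fun i hi => ?_) (prod_mem fun i hi => ?_)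
  · exact X_mem_monomialsAvoiding (hs i (by grind))
  · exact X_mem_monomialsAvoiding (hs i (by grind))

lemma mem_edgeComplementIdeal_pow_of_X_mul_mem {σ : Type*} {s : ℕ → σ} {q t : ℕ} {k : σ}
    (hs : ∀ i < q + 2, s i ≠ k) {f : MvPolynomial σ R}
    (h : X k * f ∈ edgeComplementIdeal (fun i => X (s i)) q ^ t) :
    f ∈ edgeComplementIdeal (fun i => X (s i)) q ^ t := by
  refine mem_span_pow_of_X_mul_mem_span_pow ?_ h
  rintro _ ⟨j, hj, rfl⟩
  exact edgeComplementProd_X_mem_monomialsAvoiding hs hj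

lemma not_X_dvd_X_mul_prod_range {σ : Type*} [Nontrivial R] {s : ℕ → σ} {q : ℕ} {k : σ}
    (hs : ∀ i < q + 2, s i ≠ k) :
    ¬ (X k : MvPolynomial σ R) ∣ X (s q) * ∏ i ∈ Finset.range q, X (s i) :=
  not_X_dvd_of_mem_monomialsAvoiding <| mul_mem (X_mem_monomialsAvoiding (hs q (by omega)))
    (prod_mem fun i hi => X_mem_monomialsAvoiding (hs i (by grind)))

end EdgeComplement

section EdgeBetti

/-- The value `C(q, i) C(q + t - i, t - i)`, read as zero for `i > t`, of the `i`-th Betti number of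
the `t`-th power of `edgeComplementIdeal v q` for distinct variables `v`. -/
def edgeBetti (q t i : ℕ) : ℕ :=
  if i ≤ t then q.choose i * (q + t - i).choose (t - i) else 0

lemma edgeBetti_add (q i d : ℕ) : edgeBetti q (i + d) i = q.choose i * (q + d).choose d := by
  rw [edgeBetti, if_pos (Nat.le_add_right i d), Nat.add_sub_cancel_left, Nat.add_left_comm,
    Nat.add_sub_cancel_left]

lemma edgeBetti_zero_left (t i : ℕ) : edgeBetti 0 t i = if i = 0 then 1 else 0 := by
  cases i <;> simp [edgeBetti]

lemma edgeBetti_zero_right (q i : ℕ) : edgeBetti q 0 i = if i = 0 then 1 else 0 := by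
  cases i <;> simp [edgeBetti]

lemma edgeBetti_succ_succ_zero (q t : ℕ) :
    edgeBetti (q + 1) (t + 1) 0 = edgeBetti q (t + 1) 0 + edgeBetti (q + 1) t 0 := by
  have h : (q + 1 + (t + 1)).choose (t + 1) =
      (q + (t + 1)).choose (t + 1) + (q + 1 + t).choose t := by
    rw [← add_assoc, Nat.choose_succ_succ, add_comm, add_right_comm q, add_assoc q]
  simpa [edgeBetti] using h

lemma edgeBetti_succ_succ_succ (q t i : ℕ) :
    edgeBetti (q + 1) (t + 1) (i + 1) =
      edgeBetti q (t + 1) (i + 1) + edgeBetti (q + 1) t (i + 1) + edgeBetti q t i := by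
  rcases lt_trichotomy t i with h | rfl | h
  · grind [edgeBetti]
  · simp [edgeBetti, Nat.choose_succ_succ, add_comm]
  · obtain ⟨d, rfl⟩ := Nat.exists_eq_add_of_lt h
    have hsucc : i + d + 1 + 1 = i + 1 + (d + 1) := by ring
    have hright : i + d + 1 = i + 1 + d := by ring
    have hleft : i + d + 1 = i + (d + 1) := by ring
    rw [hsucc, edgeBetti_add, edgeBetti_add, hright, edgeBetti_add, ← hright, hleft, edgeBetti_add,
      Nat.choose_succ_succ q i, Nat.succ_eq_add_one, show q + 1 + (d + 1) = q + (d + 1) + 1 by ring,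
      Nat.choose_succ_succ (q + (d + 1)), show q + 1 + d = q + (d + 1) by ring]
    ring

lemma edgeBetti_ne_zero_iff (q t i : ℕ) : edgeBetti q t i ≠ 0 ↔ i ≤ min q t := by
  rw [edgeBetti, le_min_iff]
  by_cases h : i ≤ t
  · simp only [h, if_true, and_true, Ne, mul_eq_zero, Nat.choose_eq_zero_iff]
    omega
  · simp [h]

end EdgeBetti

section PathIdeal

open MvPolynomial

variable {K : Type u} [Field K] {n : ℕ}

lemma bettiNumber_one (i : ℕ) :
    bettiNumber K n ↥(1 : Ideal (MvPolynomial (Fin n) K)) i =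
      ((if i = 0 then 1 else 0 : ℕ) : Cardinal.{u}) := by
  rw [Ideal.one_eq_top, bettiNumber_congr Submodule.topEquiv]
  cases i with
  | zero => simp [bettiNumber_self_zero]
  | succ i => simp [bettiNumber_self_succ]

theorem bettiNumber_edgeComplementIdeal_pow {s : ℕ → Fin n} {q : ℕ}
    (hs : Set.InjOn s (Set.Iio (q + 2))) (t i : ℕ) :
    bettiNumber K n ↥(edgeComplementIdeal (fun j => (X (s j) : MvPolynomial (Fin n) K)) q ^ t) i =
      edgeBetti q t i := by
  induction q generalizing t i with
  | zero => rw [edgeComplementIdeal_zero, one_pow, bettiNumber_one, edgeBetti_zero_left]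
  | succ q ihq =>
    have hne : ∀ j < q + 2, s j ≠ s (q + 2) := fun j hj =>
      hs.ne (by grind) (by grind) hj.ne
    replace ihq := ihq (hs.mono (Set.Iio_subset_Iio (by omega)))
    induction t generalizing i with
    | zero => rw [pow_zero, bettiNumber_one, edgeBetti_zero_right]
    | succ t iht =>
      let v (j : ℕ) : MvPolynomial (Fin n) K := X (s j)
      have hcolon (a) : X (s (q + 2)) * a ∈ edgeComplementIdeal v q ^ t →
          a ∈ edgeComplementIdeal v q ^ t :=
        mem_edgeComplementIdeal_pow_of_X_mul_mem hne
      obtain ⟨hzero, hsucc⟩ := bettiNumber_pow_succ_of_eq_sup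
        (prod_range_mem_edgeComplementIdeal v q) (not_X_dvd_X_mul_prod_range hne) hcolon
        (edgeComplementIdeal_succ v q)
      cases i with
      | zero => rw [hzero, ihq, iht, edgeBetti_succ_succ_zero, Nat.cast_add]
      | succ i => rw [hsucc, ihq, iht, ihq, edgeBetti_succ_succ_succ, Nat.cast_add, Nat.cast_add]

lemma cyclePathMonomial_eq_prod (q : ℕ) (k : Fin (q + 2)) : cyclePathMonomial K (q + 2) q k =
    ∏ i ∈ Finset.range q, X (Fin.ofNat (q + 2) (k + i)) :=
  rfl

lemma cyclePathMonomial_zero (q : ℕ) : cyclePathMonomial K (q + 2) q 0 =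
    edgeComplementProd (fun i => X (Fin.ofNat (q + 2) i)) q q := by
  simp [cyclePathMonomial_eq_prod, edgeComplementProd_self]

lemma cyclePathMonomial_add_two {q j : ℕ} (hj : j + 2 < q + 2) :
    cyclePathMonomial K (q + 2) q ⟨j + 2, hj⟩ =
      edgeComplementProd (fun i => X (Fin.ofNat (q + 2) i)) q j := by
  have hsplit := Finset.prod_range_add
    (fun i => (X (Fin.ofNat (q + 2) (j + 2 + i)) : MvPolynomial (Fin (q + 2)) K)) (q - j) j
  rw [Nat.sub_add_cancel (by omega)] at hsplit
  rw [cyclePathMonomial_eq_prod, edgeComplementProd, Finset.prod_Ico_eq_prod_range, mul_comm,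
    Nat.add_sub_add_right]
  refine hsplit.trans (congrArg _ (Finset.prod_congr rfl fun i _ => congrArg X ?_))
  have hwrap : j + 2 + (q - j + i) = i + (q + 2) := by omega
  simp [hwrap, Fin.ext_iff]

theorem truncatedCyclePathIdeal_eq (q : ℕ) : truncatedCyclePathIdeal K (q + 2) =
    edgeComplementIdeal (fun i => X (Fin.ofNat (q + 2) i)) q := by
  rw [truncatedCyclePathIdeal, edgeComplementIdeal]
  congr 1
  ext f
  constructor
  · rintro ⟨⟨k, hk⟩, hk1, rfl⟩
    match k with
    | 0 => exact ⟨q, Set.mem_Iic.2 le_rfl, (cyclePathMonomial_zero q).symm⟩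
    | 1 => exact absurd rfl hk1
    | j + 2 => exact ⟨j, Set.mem_Iic.2 (by omega), (cyclePathMonomial_add_two hk).symm⟩
  · rintro ⟨j, hj, rfl⟩
    rcases (Set.mem_Iic.1 hj).eq_or_lt with rfl | hj
    · exact ⟨0, zero_ne_one, (cyclePathMonomial_zero j).symm⟩
    · exact ⟨⟨j + 2, by omega⟩, by simp, (cyclePathMonomial_add_two (by omega)).symm⟩

lemma injOn_finOfNat (n : ℕ) [NeZero n] : Set.InjOn (Fin.ofNat n) (Set.Iio n) := by
  intro i hi j hj h
  simpa [Nat.mod_eq_of_lt hi, Nat.mod_eq_of_lt hj] using congrArg Fin.val h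

end PathIdeal

theorem corollary4 {K : Type u} [Field K] (n t : ℕ) (hn : 2 ≤ n) (ht : 1 ≤ t) :
    (∀ i : ℕ, bettiNumber K n ↥(truncatedCyclePathIdeal K n ^ t) i =
      ((if i ≤ t then (n - 2).choose i * (n + t - i - 2).choose (t - i) else 0 : ℕ) :
        Cardinal.{u})) ∧
    bettiProjDim K n ↥(truncatedCyclePathIdeal K n ^ t) = ((min (n - 2) t : ℕ) : WithBot ℕ∞) := by
  obtain ⟨q, rfl⟩ := Nat.exists_eq_add_of_le' hn
  have h (i : ℕ) :
      bettiNumber K (q + 2) ↥(truncatedCyclePathIdeal K (q + 2) ^ t) i = edgeBetti q t i := by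
    rw [truncatedCyclePathIdeal_eq]
    exact bettiNumber_edgeComplementIdeal_pow (injOn_finOfNat (q + 2)) t i
  refine ⟨fun i => ?_, ?_⟩
  · rw [h, edgeBetti, Nat.add_sub_cancel, show q + 2 + t - i - 2 = q + t - i by omega]
  · rw [bettiProjDim, Nat.add_sub_cancel]
    simp only [h, Nat.cast_ne_zero, edgeBetti_ne_zero_iff]
    exact (Nat.mono_cast.map_isGreatest isGreatest_Iic).csSup_eq
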